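/- A ReLU neural network $\Phi$ with $L=L(\Phi)\ge 1$ layers, input dimension $n_0$ and output dimension $n_L$ is a sequence $\Phi=((W_1,b_1),\dots,(W_L,b_L))$ with $W_i\in\mathbb{R}^{n_i\times n_{i-1}}$, $b_i\in\mathbb{R}^{n_i}$ and positive integer widths $n_i$. Its realization $R(\Phi):\mathbb{R}^{n_0}\to\mathbb{R}^{n_L}$ is $R(\Phi)(x)=x_L$, where $x_0=x$, $x_i=\sigma(W_ix_{i-1}+b_i)$ for $1\le i\le L-1$, $x_L=W_Lx_{L-1}+b_L$, and $\sigma(t)=\max\{0,t\}$ acts entrywise. Let $M(\Phi)$ denote the total number of non-zero entries of all $W_i$ and $b_i$. For $A\in\mathbb{R}^{n\times n}$ let $\mathrm{vec}(A)\in\mathbb{R}^{n^2}$ be the vector obtained by stacking the columns of $A$, let $\mathrm{matr}$ be the inverse of $\mathrm{vec}$, and let $\|\cdot\|_2$ be the spectral norm. For $\varepsilon,\delta\in(0,1)$ define $$l=l(\varepsilon,\delta):=\left\lceil\log_2\left(\log_{1-\delta}\left(\tfrac12\delta\varepsilon\right)+1\right)\right\rceil .$$ **Proposition.** There exists a universal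 constant $C>0$ such that for every integer $n\ge 1$, every $\varepsilon\in(0,1/4)$ and every $\delta\in(0,1)$ there exists a ReLU neural network $\Phi$ with $n^2$-dimensional input and $n^2$-dimensional output such that: 1. for every $A\in\mathbb{R}^{n\times n}$ with $\|A\|_2\le 1-\delta$, the matrix $I_n-A$ is invertible, and $$\sup_{A\in\mathbb{R}^{n\times n},\ \|A\|_2\le 1-\delta}\left\|(I_n-A)^{-1}-\mathrm{matr}\big(R(\Phi)(\mathrm{vec}(A))\big)\right\|_2\le\varepsilon;$$ 2. $L(\Phi)\le C\,l\,\big(\log_2(1/\varepsilon)+\log_2(1/\delta)+\log_2 n+l\big)$; 3. $M(\Phi)\le C\,2^l n^2(n+l)\big(\log_2(1/\varepsilon)+\log_2(1/\delta)+\log_2 n+l\big)$. -/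

import Mathlib

open scoped Matrix.Norms.L2Operator

noncomputable section

/-- The ReLU activation function `σ(x) = max {0, x}`. -/
def relu (x : ℝ) : ℝ := max 0 x

/-- Neural networks `((W₁, b₁), …, (W_L, b_L))`, `L ≥ 1`, with input dimension `n₀` and output
dimension `n_L`, as nonempty sequences of compatible layers: either a single (output) layer, or a
first layer `(W₁, b₁)` of positive width followed by a network `((W₂, b₂), …, (W_L, b_L))`. -/
inductive NeuralNetwork : ℕ → ℕ → Type
  | output {n m : ℕ} (W : Matrix (Fin m) (Fin n) ℝ) (b : Fin m → ℝ) : NeuralNetwork n m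
  | hidden {n k m : ℕ} (hk : 0 < k) (W : Matrix (Fin k) (Fin n) ℝ) (b : Fin k → ℝ)
      (Φ : NeuralNetwork k m) : NeuralNetwork n m

namespace NeuralNetwork

/-- The realization `R(Φ)`: every layer but the last is `x ↦ σ(W x + b)`, with `σ` the ReLU
function acting entrywise; the last layer is `x ↦ W x + b`. -/
def realize {n m : ℕ} : NeuralNetwork n m → (Fin n → ℝ) → (Fin m → ℝ)
  | output W b, x => W.mulVec x + b
  | hidden _ W b Φ, x => Φ.realize (fun i => relu ((W.mulVec x + b) i))

/-- The number of layers `L(Φ)`. -/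
def numLayers {n m : ℕ} : NeuralNetwork n m → ℕ
  | output _ _ => 1
  | hidden _ _ _ Φ => 1 + Φ.numLayers

/-- The number of non-zero parameters `‖W‖₀ + ‖b‖₀` of a layer `(W, b)`;
`hammingNorm v` is the number of non-zero entries of the vector `v`. -/
def layerParams {n m : ℕ} (W : Matrix (Fin m) (Fin n) ℝ) (b : Fin m → ℝ) : ℕ :=
  (∑ i, hammingNorm (fun j => W i j)) + hammingNorm b

/-- The total number of non-zero parameters `M(Φ)`, summed over all layers. -/
def numParams {n m : ℕ} : NeuralNetwork n m → ℕ
  | output W b => layerParams W b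
  | hidden _ W b Φ => layerParams W b + Φ.numParams

end NeuralNetwork

/-- The column-by-column vectorization `(A₁₁, …, Aₙ₁, …, A₁ₖ, …, Aₙₖ)` of an `n × k` matrix;
with indices starting at `0`, the entry `A i j` stands at position `i + n * j`. -/
def vectorize {n k : ℕ} (A : Matrix (Fin n) (Fin k) ℝ) : Fin (k * n) → ℝ :=
  fun p => A (finProdFinEquiv.symm p).2 (finProdFinEquiv.symm p).1

/-- The matrix `matr(v)` whose vectorization is `v`. -/
def matricize {n k : ℕ} (v : Fin (k * n) → ℝ) : Matrix (Fin n) (Fin k) ℝ :=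
  Matrix.of fun i j => v (finProdFinEquiv (j, i))

/-- `l(ε, δ) = ⌈log₂(log_{1-δ}(δε/2) + 1)⌉`, which is a positive integer for `ε, δ ∈ (0,1)`. -/
def neumannLevel (ε δ : ℝ) : ℕ :=
  ⌈Real.logb 2 (Real.logb (1 - δ) (1 / 2 * δ * ε) + 1)⌉₊

end

/-!
The network evaluates a partial sum of the Neumann series `(1 - A)⁻¹ = ∑ A ^ k` by repeated
squaring. Starting from `B = A` and `Q = δ • 1`, the step `(B, Q) ↦ (B ^ 2, Q * (1 + B))`
(`squareStep`) leads after `l` rounds to `Q = δ • ∑ k < 2 ^ l, A ^ k` (`squareStep_iterate`).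
For `‖A‖ ≤ 1 - δ` the truncation error is at most `(1 - δ) ^ 2 ^ l / δ`, and `neumannLevel` is
chosen to make this at most `ε / 2`. The factor `δ` keeps all exact matrices in the unit ball
(`norm_squareStep_iterate_le`), so that one step increases errors by a factor of at most `4`
(`norm_squareStep_sub_le`), and it is removed by the output layer.

A step consists of `2 * n ^ 3` scalar products, done in parallel. By polarization they reduce to
squares of numbers in `[-1, 1]`, and a square is approximated by iterating the tent map: since
`t - t ^ 2` reproduces itself under the tent map up to a factor `1 / 4` (`sub_sq_eq_tent`), `m`
layers with boundedly many parameters give the error `4 ^ (-m)` (`exists_squares`). The error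
after `l` steps is at most `5 ^ l * 4 * n ^ 3 / 4 ^ m` (`iterate_squareStep_error`), which
allows an `m` of the order of `log (1 / ε) + log (1 / δ) + log n + l` (`exists_accuracy`). The
network has about `l * m` layers, each with `O(n ^ 3)` non-zero parameters.

Networks are composed through `HiddenLayers`, the property that a map can be put in front of every
network at a given cost. This makes depth and number of parameters additive under composition. A
signed number is passed on as the pair `relu x`, `relu (-x)`, and one layer is described by
`SparseAffine` functions, which count the non-zero parameters of each neuron.
-/

/-! ### Sparse affine functions and chains of hidden layers -/

/-- `g` is an affine function of the coordinates, with at most `s` non-zero coefficients, the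
constant term included. -/
def SparseAffine {ι : Type} [Fintype ι] (s : ℕ) (g : (ι → ℝ) → ℝ) : Prop :=
  ∃ (w : ι → ℝ) (b : ℝ), (∀ x, g x = ∑ j, w j * x j + b) ∧
    hammingNorm w + (if b = 0 then 0 else 1) ≤ s

namespace SparseAffine

variable {ι : Type} [Fintype ι] {s t : ℕ} {g h : (ι → ℝ) → ℝ}

lemma mono (hg : SparseAffine s g) (hst : s ≤ t) : SparseAffine t g := by
  obtain ⟨w, b, h1, h2⟩ := hg
  exact ⟨w, b, h1, h2.trans hst⟩

lemma proj (j : ι) : SparseAffine 1 (fun x : ι → ℝ => x j) := by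
  classical
  refine ⟨Pi.single j 1, 0, fun x => by simp [Pi.single_apply], ?_⟩
  simp only [hammingNorm, Pi.single_apply, if_true, add_zero]
  exact Finset.card_le_one.2 (by simp +contextual)

lemma const (c : ℝ) : SparseAffine 1 (fun _ : ι → ℝ => c) :=
  ⟨0, c, fun x => by simp, by simp only [hammingNorm_zero]; split_ifs <;> simp⟩

lemma add (hg : SparseAffine s g) (hh : SparseAffine t h) :
    SparseAffine (s + t) (fun x => g x + h x) := by
  classical
  obtain ⟨w, b, h1, h2⟩ := hg
  obtain ⟨v, c, h3, h4⟩ := hh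
  refine ⟨w + v, b + c, fun x => ?_, ?_⟩
  · simp only [h1, h3, Pi.add_apply, add_mul, Finset.sum_add_distrib]
    ring
  · have h5 : hammingNorm (w + v) ≤ hammingNorm w + hammingNorm v := by
      unfold hammingNorm
      refine (Finset.card_le_card ?_).trans (Finset.card_union_le _ _)
      intro i hi
      simp only [Finset.mem_union, Finset.mem_filter, Finset.mem_univ, true_and,
        Pi.add_apply] at hi ⊢
      by_contra! hc
      simp [hc.1, hc.2] at hi
    have h6 : (if b + c = 0 then 0 else 1) ≤
        (if b = 0 then 0 else 1) + (if c = 0 then 0 else 1) := by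
      by_cases hb : b = 0 <;> by_cases hc : c = 0 <;> simp [hb, hc]
      split_ifs <;> simp
    omega

lemma const_mul (a : ℝ) (hg : SparseAffine s g) : SparseAffine s (fun x => a * g x) := by
  obtain ⟨w, b, h1, h2⟩ := hg
  refine ⟨a • w, a * b, fun x => ?_, ?_⟩
  · simp only [h1, mul_add, Finset.mul_sum, Pi.smul_apply, smul_eq_mul, mul_assoc]
  · have h5 : hammingNorm (a • w) ≤ hammingNorm w := hammingNorm_smul_le_hammingNorm
    have h6 : (if a * b = 0 then 0 else 1) ≤ (if b = 0 then 0 else 1) := by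
      by_cases hb : b = 0 <;> simp [hb]
      split_ifs <;> simp
    omega

lemma neg (hg : SparseAffine s g) : SparseAffine s (fun x => -g x) := by
  simpa using hg.const_mul (-1)

lemma sub (hg : SparseAffine s g) (hh : SparseAffine t h) :
    SparseAffine (s + t) (fun x => g x - h x) := by
  simpa [sub_eq_add_neg] using hg.add hh.neg

lemma sum {α : Type} (S : Finset α) {f : α → (ι → ℝ) → ℝ} (hf : ∀ a, SparseAffine s (f a)) :
    SparseAffine (S.card * s) (fun x => ∑ a ∈ S, f a x) := by
  classical
  induction S using Finset.induction_on with
  | empty => exact ⟨0, 0, fun x => by simp, by simp⟩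
  | insert a S ha ih =>
    simp only [Finset.sum_insert ha, Finset.card_insert_of_notMem ha]
    exact ((hf a).add ih).mono (by ring_nf; rfl)

lemma signed (c : Bool) (hg : SparseAffine s g) :
    SparseAffine s (fun x => cond c (g x) (-g x)) := by
  cases c
  · exact hg.neg
  · exact hg

end SparseAffine

/-- A family of sparse affine functions is `x ↦ W x + b` for a layer `(W, b)` with few non-zero
parameters, after any enumeration of the index types. -/
lemma exists_layer {ι κ : Type} [Fintype ι] [Fintype κ] {s p q : ℕ} {g : (ι → ℝ) → κ → ℝ}
    (hg : ∀ i, SparseAffine s (fun x => g x i)) (e : ι ≃ Fin p) (e' : κ ≃ Fin q) :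
    ∃ (W : Matrix (Fin q) (Fin p) ℝ) (b : Fin q → ℝ),
      (∀ x, W.mulVec x + b = g (x ∘ e) ∘ e'.symm) ∧
      NeuralNetwork.layerParams W b ≤ Fintype.card κ * s := by
  choose w b h1 h2 using hg
  refine ⟨Matrix.of fun i j => w (e'.symm i) (e.symm j), fun i => b (e'.symm i), fun x => ?_, ?_⟩
  · ext i
    simp only [Pi.add_apply, Matrix.mulVec, dotProduct, Matrix.of_apply, Function.comp_apply, h1]
    congr 1
    exact Fintype.sum_equiv e.symm _ _ (fun j => by simp)
  · have h3 : ∀ i, hammingNorm (fun j => w (e'.symm i) (e.symm j)) =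
        hammingNorm (w (e'.symm i)) := by
      intro i
      unfold hammingNorm
      refine Finset.card_equiv e.symm (fun j => ?_)
      simp
    have h4 : hammingNorm (fun i => b (e'.symm i)) =
        ∑ i, (if b (e'.symm i) = 0 then 0 else 1) := by
      unfold hammingNorm
      rw [Finset.card_filter]
      exact Finset.sum_congr rfl (fun i _ => by split_ifs <;> simp_all)
    unfold NeuralNetwork.layerParams
    simp only [Matrix.of_apply, h3, h4]
    rw [← Finset.sum_add_distrib]
    refine (Finset.sum_le_card_nsmul _ _ s (fun i _ => h2 _)).trans ?_
    simp [Fintype.card_congr e']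

/-- `f` is computed by `d` consecutive hidden layers with at most `M` non-zero parameters: `f` can
be put in front of every network at this cost, for all enumerations of the index types. -/
def HiddenLayers {ι κ : Type} (f : (ι → ℝ) → κ → ℝ) (d M : ℕ) : Prop :=
  ∀ (p q : ℕ) (e : ι ≃ Fin p) (e' : κ ≃ Fin q) (m : ℕ) (Φ : NeuralNetwork q m),
    ∃ Ψ : NeuralNetwork p m, (∀ x, Ψ.realize x = Φ.realize (f (x ∘ e) ∘ e'.symm)) ∧
      Ψ.numLayers = d + Φ.numLayers ∧ Ψ.numParams ≤ M + Φ.numParams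

namespace HiddenLayers

variable {ι κ μ : Type}

lemma mono {f : (ι → ℝ) → κ → ℝ} {d M N : ℕ} (hf : HiddenLayers f d M) (h : M ≤ N) :
    HiddenLayers f d N := by
  intro p q e e' m Φ
  obtain ⟨Ψ, h1, h2, h3⟩ := hf p q e e' m Φ
  exact ⟨Ψ, h1, h2, by omega⟩

lemma layer [Fintype ι] [Fintype κ] [Nonempty κ] {s : ℕ} {g : (ι → ℝ) → κ → ℝ}
    (hg : ∀ i, SparseAffine s (fun x => g x i)) :
    HiddenLayers (fun x i => relu (g x i)) 1 (Fintype.card κ * s) := by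
  intro p q e e' m Φ
  obtain ⟨W, b, h1, h2⟩ := exists_layer hg e e'
  have hq : 0 < q := Fin.pos (e' (Classical.arbitrary κ))
  refine ⟨.hidden hq W b Φ, fun x => ?_, rfl, Nat.add_le_add_right h2 _⟩
  simp only [NeuralNetwork.realize, h1]
  rfl

lemma comp [Fintype κ] {f : (ι → ℝ) → κ → ℝ} {g : (κ → ℝ) → μ → ℝ} {d M d' M' : ℕ}
    (hg : HiddenLayers g d' M') (hf : HiddenLayers f d M) :
    HiddenLayers (g ∘ f) (d + d') (M + M') := by
  intro p q e e' m Φ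
  obtain ⟨Ψ, h1, h2, h3⟩ := hg _ q (Fintype.equivFin κ) e' m Φ
  obtain ⟨Θ, h4, h5, h6⟩ := hf p _ e (Fintype.equivFin κ) m Ψ
  refine ⟨Θ, fun x => ?_, by omega, by omega⟩
  rw [h4, h1]
  congr 3
  ext i
  simp

/-- A loop whose step maps `G k` may depend on the position `k`: `F k` is what has been computed
after `k` rounds. -/
lemma loop [Fintype κ] {F : ℕ → (ι → ℝ) → κ → ℝ} {G : ℕ → (κ → ℝ) → κ → ℝ} {d M d' M' : ℕ}
    (h0 : HiddenLayers (F 0) d M) (hG : ∀ k, HiddenLayers (G k) d' M')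
    (hF : ∀ k, F (k + 1) = G k ∘ F k) (k : ℕ) :
    HiddenLayers (F k) (d + k * d') (M + k * M') := by
  induction k with
  | zero => simpa using h0
  | succ k ih =>
    rw [hF]
    convert (hG k).comp ih using 1 <;> ring

/-- A chain of hidden layers, followed by an affine output layer, is a network. -/
lemma exists_network [Fintype κ] [Fintype μ] {f : (ι → ℝ) → κ → ℝ} {d M s p q : ℕ}
    (hf : HiddenLayers f d M) {g : (κ → ℝ) → μ → ℝ}
    (hg : ∀ i, SparseAffine s (fun x => g x i)) (e : ι ≃ Fin p) (e' : μ ≃ Fin q) :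
    ∃ Φ : NeuralNetwork p q, (∀ x, Φ.realize x = g (f (x ∘ e)) ∘ e'.symm) ∧
      Φ.numLayers = d + 1 ∧ Φ.numParams ≤ M + Fintype.card μ * s := by
  obtain ⟨W, b, h1, h2⟩ := exists_layer hg (Fintype.equivFin κ) e'
  obtain ⟨Φ, h3, h4, h5⟩ := hf p _ e (Fintype.equivFin κ) q (.output W b)
  refine ⟨Φ, fun x => ?_, h4, h5.trans (Nat.add_le_add_left h2 _)⟩
  rw [h3]
  simp only [NeuralNetwork.realize, h1]
  congr 2
  ext i
  simp

end HiddenLayers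

/-! ### Identities for the ReLU function -/

lemma relu_of_nonneg {x : ℝ} (hx : 0 ≤ x) : relu x = x := max_eq_right hx

lemma relu_sub_relu_neg (x : ℝ) : relu x - relu (-x) = x := by
  unfold relu
  rcases le_total 0 x with h | h
  · rw [max_eq_right h, max_eq_left (by linarith)]; ring
  · rw [max_eq_left h, max_eq_right (by linarith)]; ring

lemma relu_add_relu_neg (x : ℝ) : relu x + relu (-x) = |x| := by
  unfold relu
  rcases le_total 0 x with h | h
  · rw [max_eq_right h, max_eq_left (by linarith), abs_of_nonneg h]; ring
  · rw [max_eq_left h, max_eq_right (by linarith), abs_of_nonpos h]; ring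

/-! ### Approximate squaring -/

/-- The tent map on `[0, 1]`, which increases from `0` to `1` and back to `0`. -/
noncomputable def tent (t : ℝ) : ℝ := 2 * t - 4 * relu (t - 1 / 2)

lemma tent_mem {t : ℝ} (h0 : 0 ≤ t) (h1 : t ≤ 1) : 0 ≤ tent t ∧ tent t ≤ 1 := by
  unfold tent relu
  rcases le_total (t - 1 / 2) 0 with h | h
  · rw [max_eq_left h]; constructor <;> linarith
  · rw [max_eq_right h]; constructor <;> linarith

/-- The self-similarity of the parabola `t - t ^ 2` under the tent map, which is what makes the
expansion of `t ^ 2` in iterated tent maps converge geometrically. -/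
lemma sub_sq_eq_tent (t : ℝ) : t - t ^ 2 = (tent t + (tent t - tent t ^ 2)) / 4 := by
  unfold tent relu
  rcases le_total (t - 1 / 2) 0 with h | h
  · rw [max_eq_left h]; ring
  · rw [max_eq_right h]; ring

lemma tent_iterate_mem {t : ℝ} (h0 : 0 ≤ t) (h1 : t ≤ 1) (m : ℕ) :
    0 ≤ tent^[m] t ∧ tent^[m] t ≤ 1 := by
  induction m with
  | zero => exact ⟨h0, h1⟩
  | succ m ih =>
    rw [Function.iterate_succ_apply']
    exact tent_mem ih.1 ih.2

/-- The approximation `t - ∑ tent^[k] t / 4 ^ k`, `1 ≤ k ≤ m`, of `t ^ 2` in closed form. -/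
noncomputable def sqApprox (m : ℕ) (t : ℝ) : ℝ :=
  t ^ 2 + (tent^[m] t - (tent^[m] t) ^ 2) / 4 ^ m

lemma sqApprox_zero (t : ℝ) : sqApprox 0 t = t := by simp [sqApprox]

lemma sqApprox_succ (m : ℕ) (t : ℝ) :
    sqApprox (m + 1) t = sqApprox m t - tent (tent^[m] t) / 4 ^ (m + 1) := by
  unfold sqApprox
  rw [sub_sq_eq_tent (tent^[m] t), Function.iterate_succ_apply', pow_succ]
  field_simp
  ring

lemma sqApprox_error {t : ℝ} (h0 : 0 ≤ t) (h1 : t ≤ 1) (m : ℕ) :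
    t ^ 2 ≤ sqApprox m t ∧ sqApprox m t ≤ t ^ 2 + 1 / 4 / 4 ^ m := by
  obtain ⟨h2, h3⟩ := tent_iterate_mem h0 h1 m
  unfold sqApprox
  constructor
  · have : 0 ≤ (tent^[m] t - (tent^[m] t) ^ 2) / 4 ^ m :=
      div_nonneg (by nlinarith) (by positivity)
    linarith
  · gcongr
    nlinarith [sq_nonneg (tent^[m] t - 1 / 2)]

/-- The absolute values of finitely many sparse affine functions with values in `[-1, 1]` are
squared in parallel, up to an error that decays exponentially with the number of layers. The
neurons `(p, 0)`, `(p, 1)`, `(p, 2)` that belong to `u p` carry the iterated tent map `g`,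
the value `relu (g - 1 / 2)` that the next tent map needs, and the approximate square; the first
and the last are non-negative, so that the ReLU function leaves them unchanged. -/
lemma exists_squares {ι J : Type} [Fintype ι] [Fintype J] [Nonempty J] {t : ℕ}
    {u : J → (ι → ℝ) → ℝ} (hu : ∀ p, SparseAffine t (u p)) (m : ℕ) :
    ∃ f : (ι → ℝ) → J × Fin 3 → ℝ,
      HiddenLayers f (m + 2) (Fintype.card J * (2 * t + 9 + 9 * m)) ∧
      ∀ x, (∀ p, |u p x| ≤ 1) → ∀ p,
        u p x ^ 2 ≤ f x (p, 2) ∧ f x (p, 2) ≤ u p x ^ 2 + 1 / 4 / 4 ^ m := by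
  let L0 : (ι → ℝ) → J × Bool → ℝ := fun x i => relu (cond i.2 (u i.1 x) (-u i.1 x))
  let L1 : (J × Bool → ℝ) → J × Fin 3 → ℝ := fun y i =>
    relu (![y (i.1, true) + y (i.1, false), y (i.1, true) + y (i.1, false) - 1 / 2,
      y (i.1, true) + y (i.1, false)] i.2)
  let G : ℕ → (J × Fin 3 → ℝ) → J × Fin 3 → ℝ := fun k y i =>
    relu (![2 * y (i.1, 0) - 4 * y (i.1, 1), 2 * y (i.1, 0) - 4 * y (i.1, 1) - 1 / 2,
      y (i.1, 2) - 1 / 4 ^ (k + 1) * (2 * y (i.1, 0) - 4 * y (i.1, 1))] i.2)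
  let F : ℕ → (ι → ℝ) → J × Fin 3 → ℝ := fun k =>
    Nat.rec (L1 ∘ L0) (fun k f => G k ∘ f) k
  have hL0 : HiddenLayers L0 1 (Fintype.card (J × Bool) * t) :=
    HiddenLayers.layer (fun i => (hu i.1).signed i.2)
  have hL1 : HiddenLayers L1 1 (Fintype.card (J × Fin 3) * 3) := by
    refine HiddenLayers.layer (fun i => ?_)
    obtain ⟨p, c⟩ := i
    have h := (SparseAffine.proj (p, true)).add (SparseAffine.proj (p, false))
    fin_cases c
    · exact h.mono (by norm_num)
    · exact h.sub (SparseAffine.const _)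
    · exact h.mono (by norm_num)
  have hG : ∀ k, HiddenLayers (G k) 1 (Fintype.card (J × Fin 3) * 3) := by
    refine fun k => HiddenLayers.layer (fun i => ?_)
    obtain ⟨p, c⟩ := i
    have h := ((SparseAffine.proj (p, (0 : Fin 3))).const_mul 2).sub
      ((SparseAffine.proj (p, (1 : Fin 3))).const_mul 4)
    fin_cases c
    · exact h.mono (by norm_num)
    · exact h.sub (SparseAffine.const _)
    · exact (SparseAffine.proj (p, (2 : Fin 3))).sub (h.const_mul _)
  refine ⟨F m, ?_, fun x hx p => ?_⟩
  · convert HiddenLayers.loop (F := F) (hL1.comp hL0) hG (fun k => rfl) m using 1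
    · ring
    · simp only [Fintype.card_prod, Fintype.card_bool, Fintype.card_fin]
      ring
  · have h0 := abs_nonneg (u p x)
    have key : ∀ k, F k x (p, 0) = tent^[k] |u p x| ∧
        F k x (p, 1) = relu (tent^[k] |u p x| - 1 / 2) ∧
        F k x (p, 2) = sqApprox k |u p x| := by
      intro k
      induction k with
      | zero =>
        have h1 : L0 x (p, true) + L0 x (p, false) = |u p x| := relu_add_relu_neg _
        refine ⟨?_, ?_, ?_⟩
        · change relu (L0 x (p, true) + L0 x (p, false)) = _
          rw [h1, relu_of_nonneg h0]; rfl
        · change relu (L0 x (p, true) + L0 x (p, false) - 1 / 2) = _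
          rw [h1]; rfl
        · change relu (L0 x (p, true) + L0 x (p, false)) = _
          rw [h1, relu_of_nonneg h0, sqApprox_zero]
      | succ k ih =>
        obtain ⟨h1, h2, h3⟩ := ih
        have h4 : 2 * F k x (p, 0) - 4 * F k x (p, 1) = tent^[k + 1] |u p x| := by
          rw [h1, h2, Function.iterate_succ_apply', tent]
        refine ⟨?_, ?_, ?_⟩
        · change relu (2 * F k x (p, 0) - 4 * F k x (p, 1)) = _
          rw [h4, relu_of_nonneg (tent_iterate_mem h0 (hx p) _).1]
        · change relu (2 * F k x (p, 0) - 4 * F k x (p, 1) - 1 / 2) = _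
          rw [h4]
        · change relu (F k x (p, 2) -
            1 / 4 ^ (k + 1) * (2 * F k x (p, 0) - 4 * F k x (p, 1))) = _
          have h5 : sqApprox k |u p x| - 1 / 4 ^ (k + 1) * tent^[k + 1] |u p x| =
              sqApprox (k + 1) |u p x| := by
            rw [sqApprox_succ, Function.iterate_succ_apply']; ring
          rw [h4, h3, h5, relu_of_nonneg]
          exact (sq_nonneg _).trans (sqApprox_error h0 (hx p) _).1
    rw [(key m).2.2, ← sq_abs (u p x)]
    exact sqApprox_error h0 (hx p) m

/-! ### Spectral norm estimates -/

section SpectralNorm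

variable {n : ℕ}

lemma abs_entry_le_norm (A : Matrix (Fin n) (Fin n) ℝ) (i j : Fin n) : |A i j| ≤ ‖A‖ := by
  have h := Matrix.l2_opNorm_mulVec A (EuclideanSpace.single j 1)
  rw [PiLp.norm_single, norm_one, mul_one] at h
  refine le_trans ?_ h
  have h2 := PiLp.norm_apply_le (p := 2) (WithLp.toLp 2 (A.mulVec (Pi.single j (1 : ℝ)))) i
  simpa using h2

lemma norm_single_le (i j : Fin n) (c : ℝ) : ‖Matrix.single i j c‖ ≤ |c| := by
  have h := Matrix.l2_opNorm_conjTranspose_mul_self (Matrix.single i j c)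
  rw [Matrix.conjTranspose_single, Matrix.single_mul_single_same, ← Matrix.diagonal_single,
    Matrix.l2_opNorm_diagonal, Pi.norm_single] at h
  simp only [star_trivial, norm_mul, Real.norm_eq_abs] at h
  nlinarith [norm_nonneg (Matrix.single i j c), abs_nonneg c]

lemma norm_le_of_entries_le {A : Matrix (Fin n) (Fin n) ℝ} {c : ℝ} (h : ∀ i j, |A i j| ≤ c) :
    ‖A‖ ≤ n ^ 2 * c := by
  calc ‖A‖ = ‖∑ i, ∑ j, Matrix.single i j (A i j)‖ := by
        rw [← Matrix.matrix_eq_sum_single]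
    _ ≤ ∑ i : Fin n, ∑ j : Fin n, c :=
        (norm_sum_le _ _).trans (Finset.sum_le_sum fun i _ => (norm_sum_le _ _).trans
          (Finset.sum_le_sum fun j _ => (norm_single_le i j _).trans (h i j)))
    _ = n ^ 2 * c := by simp; ring

lemma norm_one_matrix_le : ‖(1 : Matrix (Fin n) (Fin n) ℝ)‖ ≤ 1 := by
  rw [← Matrix.diagonal_one, Matrix.l2_opNorm_diagonal]
  exact (pi_norm_le_iff_of_nonneg zero_le_one).2 (fun i => by simp)

lemma norm_pow_matrix_le {A : Matrix (Fin n) (Fin n) ℝ} {r : ℝ} (h : ‖A‖ ≤ r) (k : ℕ) :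
    ‖A ^ k‖ ≤ r ^ k := by
  induction k with
  | zero => simpa using norm_one_matrix_le
  | succ k ih =>
    rw [pow_succ, pow_succ]
    exact (norm_mul_le _ _).trans
      (mul_le_mul ih h (norm_nonneg _) (pow_nonneg ((norm_nonneg _).trans h) _))

/-- The scaling by `δ` that keeps the partial sums of the Neumann series in the unit ball. -/
lemma norm_smul_geom_sum_le {A : Matrix (Fin n) (Fin n) ℝ} {δ : ℝ} (hδ : 0 < δ)
    (h : ‖A‖ ≤ 1 - δ) (N : ℕ) : ‖δ • ∑ k ∈ Finset.range N, A ^ k‖ ≤ 1 := by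
  have h0 : 0 ≤ 1 - δ := (norm_nonneg _).trans h
  have h1 : ‖∑ k ∈ Finset.range N, A ^ k‖ ≤ ∑ k ∈ Finset.range N, (1 - δ) ^ k :=
    (norm_sum_le _ _).trans (Finset.sum_le_sum fun k _ => norm_pow_matrix_le h k)
  have h2 := geom_sum_mul_neg (1 - δ) N
  have h3 : 0 ≤ (1 - δ) ^ N := pow_nonneg h0 N
  rw [norm_smul, Real.norm_of_nonneg hδ.le]
  nlinarith

lemma isUnit_one_sub_of_norm_le {A : Matrix (Fin n) (Fin n) ℝ} {δ : ℝ} (hδ : 0 < δ)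
    (h : ‖A‖ ≤ 1 - δ) : IsUnit (1 - A) := by
  have : CompleteSpace (Matrix (Fin n) (Fin n) ℝ) := FiniteDimensional.complete ℝ _
  exact isUnit_one_sub_of_norm_lt_one (by linarith)

lemma norm_inv_sub_geom_sum_le {A : Matrix (Fin n) (Fin n) ℝ} {δ : ℝ} (hδ : 0 < δ)
    (h : ‖A‖ ≤ 1 - δ) (N : ℕ) :
    ‖(1 - A)⁻¹ - ∑ k ∈ Finset.range N, A ^ k‖ ≤ (1 - δ) ^ N / δ := by
  have hu : IsUnit (1 - A).det :=
    (Matrix.isUnit_iff_isUnit_det _).1 (isUnit_one_sub_of_norm_le hδ h)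
  set R := (1 - A)⁻¹
  have h1 : R * (1 - A) = 1 := Matrix.nonsing_inv_mul _ hu
  have h2 : R - ∑ k ∈ Finset.range N, A ^ k = R * A ^ N := by
    have h3 := mul_neg_geom_sum A N
    calc R - ∑ k ∈ Finset.range N, A ^ k
        = R - R * (1 - A) * ∑ k ∈ Finset.range N, A ^ k := by rw [h1, one_mul]
      _ = R * A ^ N := by rw [mul_assoc, h3]; noncomm_ring
  have h4 : ‖R‖ ≤ 1 / δ := by
    have h5 : R = 1 + R * A := by
      rw [← h1]; noncomm_ring
    have h6 : ‖R‖ ≤ 1 + ‖R‖ * (1 - δ) := by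
      calc ‖R‖ = ‖1 + R * A‖ := by rw [← h5]
        _ ≤ 1 + ‖R‖ * (1 - δ) := (norm_add_le _ _).trans (add_le_add norm_one_matrix_le
            ((norm_mul_le _ _).trans (mul_le_mul_of_nonneg_left h (norm_nonneg _))))
    rw [le_div_iff₀ hδ]
    linarith
  rw [h2]
  calc ‖R * A ^ N‖ ≤ 1 / δ * (1 - δ) ^ N := (norm_mul_le _ _).trans
        (mul_le_mul h4 (norm_pow_matrix_le h N) (norm_nonneg _) (by positivity))
    _ = (1 - δ) ^ N / δ := by ring

end SpectralNorm

/-! ### The repeated squaring step -/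

/-- A pair `(S false, S true)` of matrices is stored by the neurons `relu (±S c i j)`, where the
sign is the last component of the index. -/
def encodePair {n : ℕ} (S : Bool → Matrix (Fin n) (Fin n) ℝ) :
    Bool × Fin n × Fin n × Bool → ℝ :=
  fun i => relu (cond i.2.2.2 (S i.1 i.2.1 i.2.2.1) (-S i.1 i.2.1 i.2.2.1))

/-- The entry of a pair of matrices that is read off from two neurons. -/
def decodeEntry {n : ℕ} (c : Bool) (i j : Fin n) (y : Bool × Fin n × Fin n × Bool → ℝ) : ℝ :=
  y (c, i, j, true) - y (c, i, j, false)

lemma decodeEntry_encodePair {n : ℕ} (S : Bool → Matrix (Fin n) (Fin n) ℝ) (c : Bool)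
    (i j : Fin n) : decodeEntry c i j (encodePair S) = S c i j :=
  relu_sub_relu_neg _

lemma sparseAffine_decodeEntry {n : ℕ} (c : Bool) (i j : Fin n) :
    SparseAffine 2 (decodeEntry c i j) :=
  (SparseAffine.proj _).sub (SparseAffine.proj _)

/-- The step `(B, Q) ↦ (B ^ 2, Q * (1 + B))` on pairs `S` with `B = S false` and `Q = S true`. -/
def squareStep {n : ℕ} (S : Bool → Matrix (Fin n) (Fin n) ℝ) :
    Bool → Matrix (Fin n) (Fin n) ℝ :=
  fun c => S c * cond c (1 + S false) (S false)

/-- Every scalar product in the two matrix products is `x * y = 16 * (((x + y) / 8) ^ 2 -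
((x - y) / 8) ^ 2)`, where the hypothesis keeps `|x|` and `|y|` at most `4`. -/
lemma exists_squareStep {n : ℕ} (hn : 1 ≤ n) (m : ℕ) :
    ∃ f : (Bool × Fin n × Fin n × Bool → ℝ) → Bool × Fin n × Fin n × Bool → ℝ,
      HiddenLayers f (m + 3) (60 * n ^ 3 * (m + 3)) ∧
      ∀ S : Bool → Matrix (Fin n) (Fin n) ℝ, (∀ c, ‖S c‖ ≤ 2) →
        ∃ T, f (encodePair S) = encodePair T ∧
          ∀ c, ‖T c - squareStep S c‖ ≤ 4 * n ^ 3 / 4 ^ m := by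
  have : NeZero n := ⟨by omega⟩
  -- the two factors of the product with index `(c, i, j, k)`
  let X : Bool × Fin n × Fin n × Fin n → (Bool × Fin n × Fin n × Bool → ℝ) → ℝ :=
    fun p => decodeEntry p.1 p.2.1 p.2.2.2
  let Y : Bool × Fin n × Fin n × Fin n → (Bool × Fin n × Fin n × Bool → ℝ) → ℝ :=
    fun p y => cond p.1 ((1 : Matrix (Fin n) (Fin n) ℝ) p.2.2.2 p.2.2.1) 0 +
      decodeEntry false p.2.2.2 p.2.2.1 y
  let u : (Bool × Fin n × Fin n × Fin n) × Bool → (Bool × Fin n × Fin n × Bool → ℝ) → ℝ :=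
    fun p y => 1 / 8 * (X p.1 y + cond p.2 (Y p.1 y) (-Y p.1 y))
  have hu : ∀ p, SparseAffine 5 (u p) := fun p =>
    ((sparseAffine_decodeEntry _ _ _).add
      (((SparseAffine.const _).add (sparseAffine_decodeEntry _ _ _)).signed p.2)).const_mul _
  obtain ⟨f, hf, hsq⟩ := exists_squares hu m
  let Z : ((((Bool × Fin n × Fin n × Fin n) × Bool) × Fin 3) → ℝ) →
      Bool → Matrix (Fin n) (Fin n) ℝ :=
    fun z c => Matrix.of fun i j =>
      ∑ k, 16 * (z (((c, i, j, k), true), 2) - z (((c, i, j, k), false), 2))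
  have hZ : ∀ c i j, SparseAffine (n * 2) (fun z => Z z c i j) := fun c i j => by
    have h := SparseAffine.sum Finset.univ (fun k : Fin n =>
      ((SparseAffine.proj ((((c, i, j, k), true), 2) :
        ((Bool × Fin n × Fin n × Fin n) × Bool) × Fin 3)).sub
        (SparseAffine.proj (((c, i, j, k), false), 2))).const_mul 16)
    rw [Finset.card_univ, Fintype.card_fin] at h
    exact h
  have hE : HiddenLayers (fun z => encodePair (Z z)) 1
      (Fintype.card (Bool × Fin n × Fin n × Bool) * (n * 2)) :=
    HiddenLayers.layer (fun i => (hZ i.1 i.2.1 i.2.2.1).signed i.2.2.2)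
  refine ⟨_, (hE.comp hf).mono ?_, fun S hS => ⟨Z (f (encodePair S)), rfl, fun c => ?_⟩⟩
  · simp only [Fintype.card_prod, Fintype.card_bool, Fintype.card_fin]
    ring_nf
    nlinarith [Nat.zero_le (n ^ 3), Nat.zero_le (n ^ 3 * m)]
  · have hent : ∀ c i j, |S c i j| ≤ 2 := fun c i j => (abs_entry_le_norm _ _ _).trans (hS c)
    have hX : ∀ p, X p (encodePair S) = S p.1 p.2.1 p.2.2.2 := fun p =>
      decodeEntry_encodePair _ _ _ _
    have hY : ∀ p, Y p (encodePair S) =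
        (cond p.1 (1 + S false) (S false)) p.2.2.2 p.2.2.1 := by
      rintro ⟨c, i, j, k⟩
      simp only [Y, decodeEntry_encodePair]
      cases c <;> simp
    have hX4 : ∀ p, |X p (encodePair S)| ≤ 4 := fun p => by
      rw [hX]; exact (hent _ _ _).trans (by norm_num)
    have hY4 : ∀ p, |Y p (encodePair S)| ≤ 4 := by
      rintro ⟨c, i, j, k⟩
      simp only [Y, decodeEntry_encodePair]
      refine (abs_add_le _ _).trans ?_
      have h1 : |cond c ((1 : Matrix (Fin n) (Fin n) ℝ) k j) 0| ≤ 1 := by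
        cases c
        · simp
        · exact (abs_entry_le_norm _ _ _).trans norm_one_matrix_le
      linarith [hent false k j]
    have hu1 : ∀ p, |u p (encodePair S)| ≤ 1 := by
      rintro ⟨p, b⟩
      have h1 := abs_le.1 (hX4 p)
      have h2 := abs_le.1 (hY4 p)
      rw [abs_le]
      cases b <;> simp only [u, cond_true, cond_false] <;> constructor <;> linarith
    have hentry : ∀ i j, |(Z (f (encodePair S)) c - squareStep S c) i j| ≤ n * (4 / 4 ^ m) := by
      intro i j
      have h1 : (Z (f (encodePair S)) c - squareStep S c) i j =
          ∑ k, (16 * (f (encodePair S) (((c, i, j, k), true), 2) -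
            f (encodePair S) (((c, i, j, k), false), 2)) -
            X (c, i, j, k) (encodePair S) * Y (c, i, j, k) (encodePair S)) := by
        rw [Finset.sum_sub_distrib]
        simp only [hX, hY]
        rfl
      rw [h1]
      refine (Finset.abs_sum_le_sum_abs _ _).trans
        ((Finset.sum_le_card_nsmul _ _ (4 / 4 ^ m) (fun k _ => ?_)).trans (by simp))
      have h2 := hsq _ hu1 ((c, i, j, k), true)
      have h3 := hsq _ hu1 ((c, i, j, k), false)
      have h4 : X (c, i, j, k) (encodePair S) * Y (c, i, j, k) (encodePair S) =
          16 * (u ((c, i, j, k), true) (encodePair S) ^ 2 -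
            u ((c, i, j, k), false) (encodePair S) ^ 2) := by
        simp only [u, cond_true, cond_false]; ring
      have h5 : (4 : ℝ) / 4 ^ m = 16 * (1 / 4 / 4 ^ m) := by ring
      rw [h4, h5, abs_le]
      constructor <;> linarith
    refine (norm_le_of_entries_le hentry).trans (le_of_eq ?_)
    ring

/-! ### Iteration of the step and propagation of errors -/

/-- The pair `(A, δ)` from which the repeated squaring starts. -/
def initialPair {n : ℕ} (δ : ℝ) (A : Matrix (Fin n) (Fin n) ℝ) :
    Bool → Matrix (Fin n) (Fin n) ℝ :=
  fun c => cond c (δ • 1) A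

lemma squareStep_iterate {n : ℕ} (δ : ℝ) (A : Matrix (Fin n) (Fin n) ℝ) (j : ℕ) :
    squareStep^[j] (initialPair δ A) =
      fun c => cond c (δ • ∑ k ∈ Finset.range (2 ^ j), A ^ k) (A ^ 2 ^ j) := by
  induction j with
  | zero =>
    simp only [Function.iterate_zero, id_eq, pow_zero, Finset.range_one, Finset.sum_singleton,
      pow_one]
    rfl
  | succ j ih =>
    rw [Function.iterate_succ_apply', ih]
    funext c
    cases c
    · simp only [squareStep, cond_false]
      rw [← pow_add, pow_succ, mul_two]
    · simp only [squareStep, cond_true, cond_false]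
      rw [smul_mul_assoc, pow_succ 2 j, mul_two, Finset.sum_range_add, mul_add, mul_one,
        Finset.sum_mul]
      simp only [← pow_add, add_comm]

lemma norm_squareStep_iterate_le {n : ℕ} {δ : ℝ} (hδ : 0 < δ) {A : Matrix (Fin n) (Fin n) ℝ}
    (hA : ‖A‖ ≤ 1 - δ) (j : ℕ) (c : Bool) : ‖squareStep^[j] (initialPair δ A) c‖ ≤ 1 := by
  rw [squareStep_iterate]
  cases c
  · exact (norm_pow_matrix_le hA _).trans
      (pow_le_one₀ ((norm_nonneg _).trans hA) (by linarith))
  · exact norm_smul_geom_sum_le hδ hA _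

lemma norm_squareStep_sub_le {n : ℕ} {S E : Bool → Matrix (Fin n) (Fin n) ℝ} {e : ℝ}
    (he : e ≤ 1) (hE : ∀ c, ‖E c‖ ≤ 1) (hS : ∀ c, ‖S c - E c‖ ≤ e) (c : Bool) :
    ‖squareStep S c - squareStep E c‖ ≤ 4 * e := by
  have he0 : 0 ≤ e := (norm_nonneg _).trans (hS c)
  have h2 : ‖S false‖ ≤ 2 := by
    have := norm_le_norm_add_norm_sub (E false) (S false)
    rw [norm_sub_rev] at this
    linarith [hE false, hS false]
  have h3 : ‖cond c (1 + S false) (S false)‖ ≤ 3 := by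
    cases c
    · exact h2.trans (by norm_num)
    · exact (norm_add_le _ _).trans (by linarith [norm_one_matrix_le (n := n)])
  have h4 : ‖cond c (1 + S false) (S false) - cond c (1 + E false) (E false)‖ ≤ e := by
    cases c
    · exact hS false
    · simpa using hS false
  have h5 : squareStep S c - squareStep E c =
      (S c - E c) * cond c (1 + S false) (S false) +
        E c * (cond c (1 + S false) (S false) - cond c (1 + E false) (E false)) := by
    simp only [squareStep]; noncomm_ring
  rw [h5]
  calc _ ≤ e * 3 + 1 * e := (norm_add_le _ _).trans (add_le_add
        ((norm_mul_le _ _).trans (mul_le_mul (hS c) h3 (norm_nonneg _) he0))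
        ((norm_mul_le _ _).trans (mul_le_mul (hE c) h4 (norm_nonneg _) zero_le_one)))
    _ = 4 * e := by ring

/-- If the steps are computed up to `η`, the error after `j` steps is at most `(5 ^ j - 1) * η`:
a step multiplies it by at most `4`, as long as it is at most `1`, and adds `η`. -/
lemma iterate_squareStep_error {n : ℕ} {δ η : ℝ} (hδ : 0 < δ) (hη : 0 ≤ η)
    {A : Matrix (Fin n) (Fin n) ℝ} (hA : ‖A‖ ≤ 1 - δ)
    {f : (Bool × Fin n × Fin n × Bool → ℝ) → Bool × Fin n × Fin n × Bool → ℝ}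
    (hf : ∀ S : Bool → Matrix (Fin n) (Fin n) ℝ, (∀ c, ‖S c‖ ≤ 2) →
      ∃ T, f (encodePair S) = encodePair T ∧ ∀ c, ‖T c - squareStep S c‖ ≤ η)
    (l : ℕ) (hl : 5 ^ l * η ≤ 1) :
    ∃ T, f^[l] (encodePair (initialPair δ A)) = encodePair T ∧
      ∀ c, ‖T c - squareStep^[l] (initialPair δ A) c‖ ≤ (5 ^ l - 1) * η := by
  induction l with
  | zero => exact ⟨initialPair δ A, rfl, by simp⟩
  | succ l ih =>
    have h5 : 0 ≤ 5 ^ l * η := by positivity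
    have hl' : 5 ^ l * η ≤ 1 := by rw [pow_succ] at hl; nlinarith
    obtain ⟨S, hS, hSe⟩ := ih hl'
    have hE := norm_squareStep_iterate_le hδ hA l
    have he : (5 ^ l - 1) * η ≤ 1 := by linarith
    obtain ⟨T, hT, hTe⟩ := hf S (fun c => by
      have := norm_le_norm_add_norm_sub (squareStep^[l] (initialPair δ A) c) (S c)
      rw [norm_sub_rev] at this
      linarith [hE c, hSe c])
    refine ⟨T, by rw [Function.iterate_succ_apply', hS, hT], fun c => ?_⟩
    rw [Function.iterate_succ_apply']
    have h1 := norm_squareStep_sub_le he hE hSe c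
    have h2 := norm_sub_le_norm_sub_add_norm_sub (T c) (squareStep S c)
      (squareStep (squareStep^[l] (initialPair δ A)) c)
    rw [pow_succ]
    linarith [hTe c]

/-- For all accuracies `m` of the squaring subnetworks and all numbers `l` of steps there is a
network that approximates the inverse of `1 - A`; the two parts of the error are the tail of the
Neumann series and the accumulated errors of the scalar products. -/
lemma exists_network_inverse {n : ℕ} (hn : 1 ≤ n) {δ : ℝ} (hδ : 0 < δ) (l m : ℕ)
    (hm : 5 ^ l * (4 * n ^ 3 / 4 ^ m) ≤ (1 : ℝ)) :
    ∃ Φ : NeuralNetwork (n * n) (n * n),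
      (∀ A : Matrix (Fin n) (Fin n) ℝ, ‖A‖ ≤ 1 - δ →
        ‖(1 - A)⁻¹ - matricize (Φ.realize (vectorize A))‖ ≤
          (1 - δ) ^ 2 ^ l / δ + 5 ^ l * (4 * n ^ 3 / 4 ^ m) / δ) ∧
      Φ.numLayers = l * (m + 3) + 2 ∧
      Φ.numParams ≤ 60 * n ^ 3 * (l * (m + 3)) + 6 * n ^ 2 := by
  have : NeZero n := ⟨by omega⟩
  obtain ⟨f, hf, hstep⟩ := exists_squareStep hn m
  -- `matricize` and `vectorize` list the entry in row `i` and column `j` at the pair `(j, i)`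
  let F0 : (Fin n × Fin n → ℝ) → Bool × Fin n × Fin n × Bool → ℝ :=
    fun x => encodePair (initialPair δ (Matrix.of fun i j => x (j, i)))
  have hF0 : HiddenLayers F0 1 (Fintype.card (Bool × Fin n × Fin n × Bool) * 1) := by
    refine HiddenLayers.layer (fun i => SparseAffine.signed i.2.2.2 ?_)
    obtain ⟨c, i, j, b⟩ := i
    cases c
    · exact SparseAffine.proj (j, i)
    · exact SparseAffine.const ((δ • (1 : Matrix (Fin n) (Fin n) ℝ)) i j)
  have hF := HiddenLayers.loop (F := fun k => f^[k] ∘ F0) hF0 (fun _ => hf)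
    (fun k => by rw [Function.iterate_succ']; rfl) l
  let g : (Bool × Fin n × Fin n × Bool → ℝ) → Fin n × Fin n → ℝ :=
    fun y p => δ⁻¹ * decodeEntry true p.2 p.1 y
  obtain ⟨Φ, hΦ, hL, hM⟩ := hF.exists_network (g := g)
    (fun p => (sparseAffine_decodeEntry true p.2 p.1).const_mul δ⁻¹)
    finProdFinEquiv finProdFinEquiv
  refine ⟨Φ, fun A hA => ?_, by rw [hL]; ring, hM.trans (le_of_eq ?_)⟩
  · obtain ⟨T, hT, hTe⟩ := iterate_squareStep_error hδ (by positivity) hA hstep l hm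
    have hin : F0 (vectorize A ∘ finProdFinEquiv) = encodePair (initialPair δ A) := by
      simp only [F0]
      congr 2
      ext i j
      simp [vectorize]
    have hout : matricize (Φ.realize (vectorize A)) = δ⁻¹ • T true := by
      ext i j
      rw [hΦ]
      simp only [matricize, Matrix.of_apply, Function.comp_apply, Equiv.symm_apply_apply, g]
      rw [hin, hT, decodeEntry_encodePair]
      rfl
    have hTt := hTe true
    rw [squareStep_iterate] at hTt
    simp only [cond_true] at hTt
    set N := ∑ k ∈ Finset.range (2 ^ l), A ^ k
    have h1 : N - δ⁻¹ • T true = δ⁻¹ • (δ • N - T true) := by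
      rw [smul_sub, smul_smul, inv_mul_cancel₀ hδ.ne', one_smul]
    have h2 : ‖N - δ⁻¹ • T true‖ ≤ 5 ^ l * (4 * n ^ 3 / 4 ^ m) / δ := by
      rw [h1, norm_smul, norm_sub_rev, Real.norm_of_nonneg (by positivity), ← div_eq_inv_mul]
      gcongr
      refine hTt.trans (mul_le_mul_of_nonneg_right (by linarith) (by positivity))
    rw [hout]
    exact (norm_sub_le_norm_sub_add_norm_sub _ N _).trans
      (add_le_add (norm_inv_sub_geom_sum_le hδ hA _) h2)
  · simp only [Fintype.card_prod, Fintype.card_bool, Fintype.card_fin]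
    ring

/-! ### The choice of the parameters -/

lemma one_sub_pow_neumannLevel_le {ε δ : ℝ} (hε : 0 < ε) (hδ : 0 < δ) (hδ1 : δ < 1) :
    (1 - δ) ^ 2 ^ neumannLevel ε δ ≤ 1 / 2 * δ * ε := by
  have hx : 0 < 1 / 2 * δ * ε := by positivity
  set y := Real.logb (1 - δ) (1 / 2 * δ * ε)
  have hpow : (1 - δ) ^ y = 1 / 2 * δ * ε :=
    Real.rpow_logb (by linarith) (by linarith) hx
  have hyl : y ≤ ((2 ^ neumannLevel ε δ : ℕ) : ℝ) := by
    rcases le_or_gt (y + 1) 0 with h | h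
    · exact le_trans (by linarith) (Nat.cast_nonneg _)
    · have h1 : Real.logb 2 (y + 1) ≤ neumannLevel ε δ := Nat.le_ceil _
      rw [Real.logb_le_iff_le_rpow (by norm_num) h, Real.rpow_natCast] at h1
      push_cast
      linarith
  rw [← hpow, ← Real.rpow_natCast]
  exact Real.rpow_le_rpow_of_exponent_ge (by linarith) (by linarith) hyl

lemma one_le_neumannLevel {ε δ : ℝ} (hε : 0 < ε) (hε1 : ε < 1) (hδ : 0 < δ) (hδ1 : δ < 1) :
    1 ≤ neumannLevel ε δ := by
  have h1 : 1 / 2 * δ * ε < 1 := by nlinarith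
  have h2 : 0 < Real.logb (1 - δ) (1 / 2 * δ * ε) :=
    Real.logb_pos_of_base_lt_one (by linarith) (by linarith) (by positivity) h1
  exact Nat.one_le_ceil_iff.2 (Real.logb_pos (by norm_num) (by linarith))

/-- The accuracy of the squaring subnetworks: it suffices that `m` is of the order of
`log (1 / ε) + log (1 / δ) + log n + l`. -/
lemma exists_accuracy {n l : ℕ} (hn : 1 ≤ n) {ε δ : ℝ} (hε : 0 < ε) (hε1 : ε < 1) (hδ : 0 < δ)
    (hδ1 : δ < 1) :
    ∃ m : ℕ, 5 ^ l * (4 * n ^ 3 / 4 ^ m) ≤ 1 / 2 * δ * ε ∧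
      (m : ℝ) ≤ 3 * (Real.logb 2 (1 / ε) + Real.logb 2 (1 / δ) + Real.logb 2 n + l) + 4 := by
  have hn0 : (1 : ℝ) ≤ n := by exact_mod_cast hn
  have hn' : (0 : ℝ) < n := by linarith
  -- `5 ^ l` is replaced by `(2 ^ 3) ^ l`, which has an integral logarithm
  set z : ℝ := 2 ^ 3 * (n ^ 3 * ((2 ^ 3) ^ l * (1 / δ * (1 / ε)))) with hz
  have hz0 : 0 < z := by positivity
  have hlog : Real.logb 2 z = 3 + (3 * Real.logb 2 n + (3 * l + (Real.logb 2 (1 / δ) +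
      Real.logb 2 (1 / ε)))) := by
    have h2 : Real.logb 2 2 = 1 := Real.logb_self_eq_one (by norm_num)
    rw [hz, Real.logb_mul (by positivity) (by positivity),
      Real.logb_mul (by positivity) (by positivity), Real.logb_mul (by positivity) (by positivity),
      Real.logb_mul (by positivity) (by positivity), Real.logb_pow, Real.logb_pow, Real.logb_pow,
      Real.logb_pow, h2]
    push_cast
    ring
  have ha : 0 ≤ Real.logb 2 (1 / ε) :=
    Real.logb_nonneg (by norm_num) ((one_le_div hε).2 hε1.le)
  have hb : 0 ≤ Real.logb 2 (1 / δ) :=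
    Real.logb_nonneg (by norm_num) ((one_le_div hδ).2 hδ1.le)
  have hc : 0 ≤ Real.logb 2 n := Real.logb_nonneg (by norm_num) hn0
  have hlog0 : 0 ≤ Real.logb 2 z := by rw [hlog]; positivity
  refine ⟨⌈Real.logb 2 z⌉₊, ?_, ?_⟩
  · have h1 : z ≤ 2 ^ ⌈Real.logb 2 z⌉₊ := by
      have := Nat.le_ceil (Real.logb 2 z)
      rwa [Real.logb_le_iff_le_rpow (by norm_num) hz0, Real.rpow_natCast] at this
    have h2 : z ≤ 4 ^ ⌈Real.logb 2 z⌉₊ :=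
      h1.trans (pow_le_pow_left₀ (by norm_num) (by norm_num) _)
    calc (5 : ℝ) ^ l * (4 * n ^ 3 / 4 ^ ⌈Real.logb 2 z⌉₊)
        ≤ (2 ^ 3) ^ l * (4 * n ^ 3 / z) := by gcongr; norm_num
      _ = 1 / 2 * δ * ε := by rw [hz]; field_simp; norm_num
  · have := Nat.ceil_lt_add_one hlog0
    rw [hlog] at this ⊢
    linarith

/-- `‖·‖` on matrices is the spectral norm (the operator norm induced by the Euclidean norm). -/
theorem mainTheorem2 :
    ∃ C : ℝ, 0 < C ∧
      ∀ (n : ℕ) (ε δ : ℝ), 1 ≤ n → 0 < ε → ε < 1 / 4 → 0 < δ → δ < 1 →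
        ∃ Φ : NeuralNetwork (n * n) (n * n),
          (∀ A : Matrix (Fin n) (Fin n) ℝ, ‖A‖ ≤ 1 - δ →
            IsUnit (1 - A) ∧
              ‖(1 - A)⁻¹ - matricize (Φ.realize (vectorize A))‖ ≤ ε) ∧
          (Φ.numLayers : ℝ) ≤
            C * (neumannLevel ε δ : ℝ) *
              (Real.logb 2 (1 / ε) + Real.logb 2 (1 / δ) + Real.logb 2 (n : ℝ)
                + (neumannLevel ε δ : ℝ)) ∧
          (Φ.numParams : ℝ) ≤
            C * (2 : ℝ) ^ neumannLevel ε δ * (n : ℝ) ^ 2 * ((n : ℝ) + (neumannLevel ε δ : ℝ)) *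
              (Real.logb 2 (1 / ε) + Real.logb 2 (1 / δ) + Real.logb 2 (n : ℝ)
                + (neumannLevel ε δ : ℝ)) := by
  refine ⟨700, by norm_num, fun n ε δ hn hε hε1 hδ hδ1 => ?_⟩
  set l := neumannLevel ε δ
  have hl1 : 1 ≤ l := one_le_neumannLevel hε (by linarith) hδ hδ1
  obtain ⟨m, hm, hmX⟩ := exists_accuracy (l := l) hn hε (by linarith) hδ hδ1
  obtain ⟨Φ, hΦ, hL, hM⟩ := exists_network_inverse hn hδ l m (hm.trans (by nlinarith))
  have hn0 : (1 : ℝ) ≤ n := by exact_mod_cast hn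
  have hl0 : (1 : ℝ) ≤ l := by exact_mod_cast hl1
  set X := Real.logb 2 (1 / ε) + Real.logb 2 (1 / δ) + Real.logb 2 (n : ℝ) + (l : ℝ) with hX
  have hX1 : 1 ≤ X := by
    have ha : 0 ≤ Real.logb 2 (1 / ε) :=
      Real.logb_nonneg (by norm_num) ((one_le_div hε).2 (by linarith))
    have hb : 0 ≤ Real.logb 2 (1 / δ) :=
      Real.logb_nonneg (by norm_num) ((one_le_div hδ).2 hδ1.le)
    have hc : 0 ≤ Real.logb 2 n := Real.logb_nonneg (by norm_num) hn0
    linarith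
  have hm10 : (m : ℝ) + 3 ≤ 10 * X := by linarith
  have hlX : 1 ≤ l * X := one_le_mul_of_one_le_of_one_le hl0 hX1
  have hlm : (l : ℝ) * (m + 3) ≤ l * (10 * X) := by gcongr
  refine ⟨Φ, fun A hA => ⟨isUnit_one_sub_of_norm_le hδ hA, (hΦ A hA).trans ?_⟩, ?_, ?_⟩
  · calc (1 - δ) ^ 2 ^ l / δ + 5 ^ l * (4 * n ^ 3 / 4 ^ m) / δ
        ≤ 1 / 2 * δ * ε / δ + 1 / 2 * δ * ε / δ := by
          gcongr
          exact one_sub_pow_neumannLevel_le hε hδ hδ1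
      _ = ε := by field_simp; ring
  · rw [hL]
    push_cast
    linarith
  · have h2l : (l : ℝ) ≤ 2 ^ l := by exact_mod_cast Nat.lt_two_pow_self.le
    have hM' : (Φ.numParams : ℝ) ≤ 60 * n ^ 3 * (l * (m + 3)) + 6 * n ^ 2 := by
      exact_mod_cast hM
    have hn23 : (n : ℝ) ^ 2 ≤ n ^ 3 := pow_le_pow_right₀ hn0 (by norm_num)
    calc (Φ.numParams : ℝ) ≤ 60 * n ^ 3 * (l * (10 * X)) + 6 * (n ^ 3 * (l * X)) := by
          refine hM'.trans (add_le_add (by gcongr) ?_)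
          nlinarith [mul_le_mul_of_nonneg_left hlX (by positivity : (0 : ℝ) ≤ n ^ 3)]
      _ = 606 * l * n ^ 2 * n * X := by ring
      _ ≤ 700 * 2 ^ l * n ^ 2 * (n + l) * X := by
          gcongr
          · norm_num
          · linarith
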